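/- **Setting (random energy model).** For $N\ge 1$ let $(J_\alpha)_{\alpha\subset\{1,\dots,N\}}$ be i.i.d. standard Gaussian random variables; for all $N$ they live on one probability space $(\Omega,\Sigma,\mathbb P)$, and no assumption is made on the joint law of the families belonging to different $N$. For $\sigma\in\{-1,+1\}^N$ put $$H_N(\sigma)=-\frac{N^{1/2}}{2^{N/2}}\sum_{\alpha\subset\{1,\dots,N\}}J_\alpha\prod_{i\in\alpha}\sigma_i ,\qquad \mu_{N,\beta}(\sigma)=\frac{e^{-\beta H_N(\sigma)}}{\sum_{\tau\in\{-1,+1\}^N}e^{-\beta H_N(\tau)}} .$$ Let $(\tilde\sigma)_1,\dots,(\tilde\sigma)_{2^N}$ be the configurations listed in nondecreasing order of energy $H_N$ (ties, which have probability $0$ for $N\ge1$, are broken by a fixed enumeration), and let $\nu_{k_N}$ be the uniform probability measure on $\{(\tilde\sigma)_1,\dots,(\tilde\sigma)_{k_N}\}$ (on all of $\{-1,+1\}^N$ if $k_N>2^N$). For probability measures on $\{-1,+1\}^N$ let $d_{\mathrm{TV}}(\mu,\nu)=\sup_{\|\Psi\|_\infty=1}|\mu(\Psi)-\nu(\Psi)|$.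 Put $\beta_c=\sqrt{2\log 2}$. Let $(W_\ell)_{\ell\ge1}$ be i.i.d. exponential random variables of mean $1$ on the same probability space (jointly with the $J$'s in any way), and $$\zeta(\beta)=\lim_{k\to\infty}\sum_{j=2}^{k}\exp\Big(-\frac{\beta}{\beta_c}\sum_{\ell=1}^{j}\frac{W_\ell}{\ell}\Big).$$ **Property 4.** Let $\beta_c<\beta<\infty$ and let $(k_N)$ be integers with $k_N\to\infty$, $k_N/N\to\infty$ and $(\log k_N)(\log N)/N\to0$ as $N\to\infty$. Then, with probability $1$, the limit $\zeta(\beta)$ exists and is finite, the Gibbs measure $\mu_{N,\beta}$ is different from the uniform measure $\nu_{k_N}$ on the $k_N$ lowest configurations for all sufficiently large $N$, and $$\liminf_{N\to\infty} d_{\mathrm{TV}}(\mu_{N,\beta},\nu_{k_N})\ \ge\ \frac{1}{1+\zeta(\beta)}\ >\ 0 .$$ -/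

import Mathlib

open MeasureTheory ProbabilityTheory Filter Topology

noncomputable section

namespace REM

/-- Spin configurations `σ ∈ {-1, +1}^N`. -/
abbrev Config (N : ℕ) : Type := Fin N → ℤˣ

instance : MeasurableSingletonClass ℤˣ :=
  ⟨fun u => ⟨{(u : ℤ)}, measurableSet_singleton _, by
    ext v
    simp [Units.ext_iff]⟩⟩

/-- `σ_α = ∏_{i ∈ α} σ_i` as a real number, with `σ_∅ = 1`. -/
def spinProd {N : ℕ} (α : Finset (Fin N)) (σ : Config N) : ℝ :=
  ∏ i ∈ α, ((σ i : ℤ) : ℝ)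

/-- The Hamiltonian of the random energy model for given couplings `J_α`, `α ⊆ {1, …, N}`:
`H(σ) = -(N^{1/2} / 2^{N/2}) ∑_α J_α σ_α`. -/
def hamiltonian {N : ℕ} (J : Finset (Fin N) → ℝ) (σ : Config N) : ℝ :=
  -(Real.sqrt N / (2 : ℝ) ^ ((N : ℝ) / 2)) * ∑ α : Finset (Fin N), J α * spinProd α σ

/-- The partition function `Z_N(β) = ∑_σ exp(-β H(σ))`. -/
def partitionFn {N : ℕ} (H : Config N → ℝ) (β : ℝ) : ℝ :=
  ∑ σ : Config N, Real.exp (-β * H σ)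

/-- The finite volume Gibbs measure, giving `σ` the weight `exp(-β H(σ)) / Z_N(β)`. -/
def gibbs {N : ℕ} (H : Config N → ℝ) (β : ℝ) : Measure (Config N) :=
  ∑ σ : Config N,
    ENNReal.ofReal (Real.exp (-β * H σ) / partitionFn H β) • Measure.dirac σ

/-- The configurations listed in nondecreasing order of energy: entry `j` (counted from `0`) is the
configuration with the `(j+1)`-st lowest energy. Ties, if there are any, are broken
according to a fixed enumeration of the configurations. -/
def sortedConfig {N : ℕ} (H : Config N → ℝ) (j : Fin (Fintype.card (Config N))) : Config N :=
  (Fintype.equivFin (Config N)).symm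
    (Tuple.sort (fun i => H ((Fintype.equivFin (Config N)).symm i)) j)

/-- The set of the first `k` configurations in nondecreasing order of energy. -/
def lowest {N : ℕ} (H : Config N → ℝ) (k : ℕ) : Set (Config N) :=
  sortedConfig H '' {j | (j : ℕ) < k}

/-- The uniform measure on the `k` configurations of lowest energy. -/
def uniformLowest {N : ℕ} (H : Config N → ℝ) (k : ℕ) : Measure (Config N) :=
  uniformOn (lowest H k)

/-- Total variation distance, `sup |μ(Ψ) - ν(Ψ)|` over real functions `Ψ` of sup norm `1`. -/
def dTV {N : ℕ} (μ ν : Measure (Config N)) : ℝ :=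
  sSup {d : ℝ | ∃ Ψ : Config N → ℝ, ‖Ψ‖ = 1 ∧ d = |∫ σ, Ψ σ ∂μ - ∫ σ, Ψ σ ∂ν|}

/-- The critical inverse temperature `β_c = √(2 log 2)`. -/
def betaC : ℝ := Real.sqrt (2 * Real.log 2)

/-- `ζ_k(β) = ∑_{j=2}^k exp(-(β/β_c) ∑_{ℓ=1}^j W_ℓ/ℓ)`. The sequence `w` is indexed from `0`,
so `w i` is `W_{i+1}`. -/
def zetaPartial (β : ℝ) (w : ℕ → ℝ) (k : ℕ) : ℝ :=
  ∑ j ∈ Finset.Icc 2 k,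
    Real.exp (-(β / betaC) * ∑ i ∈ Finset.range j, w i / ((i : ℝ) + 1))

/-- `ζ(β) = lim_{k → ∞} ζ_k(β)` (meaningful when this limit exists). -/
def zeta (β : ℝ) (w : ℕ → ℝ) : ℝ :=
  limUnder atTop (zetaPartial β w)

end REM

end

/-! As `ζ ≥ 0`, it suffices that the distance, which ranges up to 2 in this normalization, is almost
surely at least 1 for all large `N`; no Poisson limit of the energies is needed. The Gibbs measure
sits on too few configurations for the uniform measure to see them.

The energies are `-√N X_σ` with `2^N` independent standard Gaussians `X_σ`. Let `x = level 1 N`, `x'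
= level (1/2 + γ) N` and `A = {X > x}`. The sum `S` of the weights `min(1, e^{β√N(X_σ - x)})`
dominates both `|A|` and, up to the factor `e^{β√N x}`, the Boltzmann mass off `A`. Its mean is
`O(√N)`, since `β > β_c`. Hence `A` has uniform mass `O(N^{-1/2})` once `k_N ≥ N`. Some `X_σ`
exceeds `x'`, so the Gibbs mass off `A` is at most `S e^{-β√N(x' - x)}`, a negative power of `N` for
small `γ` (`dTV_gibbs_uniformLowest_ge`).

Both events fail with probability at most `exp(-c N^δ)` for some `δ > 0`. Borel–Cantelli then
applies whatever the joint law across different `N`. Finiteness of `ζ` follows from that of the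
expected series. -/

namespace REM

/-! ### Energies as independent Gaussians -/

section Gaussian

variable {Ω : Type*} [MeasurableSpace Ω] {P : Measure Ω} [IsProbabilityMeasure P]

/-- An orthonormal linear image of a standard Gaussian family is a standard Gaussian family. -/
theorem orthonormal_image_gaussian {ι κ : Type*} [Fintype ι] [Fintype κ] [DecidableEq κ]
    {J : ι → Ω → ℝ} (hlaw : ∀ i, HasLaw (J i) (gaussianReal 0 1) P) (hind : iIndepFun J P)
    (c : ι → κ → ℝ) (hc : ∀ s t, ∑ i, c i s * c i t = if s = t then 1 else 0) :
    (∀ s, HasLaw (fun ω => ∑ i, c i s * J i ω) (gaussianReal 0 1) P) ∧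
      iIndepFun (fun s ω => ∑ i, c i s * J i ω) P := by
  classical
  have hG : HasGaussianLaw (fun ω i => J i ω) P :=
    hind.hasGaussianLaw fun i => (hlaw i).hasGaussianLaw
  have hL2 : ∀ i, MemLp (J i) 2 P := fun i => (hlaw i).hasGaussianLaw.memLp_two
  have hcov : ∀ i j, cov[J i, J j; P] = if i = j then 1 else 0 := by
    intro i j
    split_ifs with h
    · subst h
      rw [covariance_self (hlaw i).aemeasurable, (hlaw i).variance_eq]
      simp
    · exact (hind.indepFun h).covariance_eq_zero (hL2 i) (hL2 j)
  let L : (ι → ℝ) →L[ℝ] (κ → ℝ) :=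
    ContinuousLinearMap.pi fun s => ∑ i, c i s • ContinuousLinearMap.proj i
  have hX : HasGaussianLaw (fun ω s => ∑ i, c i s * J i ω) P := by
    have := hG.map_fun L
    convert! this using 3
    simp [L]
  have hcovX : ∀ s t, cov[fun ω => ∑ i, c i s * J i ω, fun ω => ∑ i, c i t * J i ω; P] =
      if s = t then 1 else 0 := by
    intro s t
    rw [covariance_fun_sum_fun_sum (fun i => (hL2 i).const_mul _) fun i => (hL2 i).const_mul _]
    simp only [covariance_const_mul_left, covariance_const_mul_right, hcov]
    rw [← hc s t]
    simp [mul_comm]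
  refine ⟨fun s => ⟨(hX.eval s).aemeasurable, ?_⟩, ?_⟩
  · have h1 : ∫ ω, ∑ i, c i s * J i ω ∂P = 0 := by
      rw [integral_finsetSum _ fun i _ => ((hL2 i).integrable (by norm_num)).const_mul _]
      refine Finset.sum_eq_zero fun i _ => ?_
      rw [integral_const_mul, (hlaw i).integral_eq]
      simp
    have h2 : Var[fun ω => ∑ i, c i s * J i ω; P] = 1 := by
      rw [← covariance_self (hX.eval s).aemeasurable, hcovX]
      simp
    rw [(hX.eval s).map_eq_gaussianReal, h1, h2]
    simp
  · refine hX.iIndepFun_of_covariance_eq_zero fun s t hst => ?_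
    rw [hcovX, if_neg hst]

end Gaussian

/-- The energy in units of `-√N`: `X_σ = 2^{-N/2} ∑_α J_α σ_α`. -/
noncomputable def walsh {N : ℕ} (J : Finset (Fin N) → ℝ) (σ : Config N) : ℝ :=
  ∑ α : Finset (Fin N), ((2 : ℝ) ^ ((N : ℝ) / 2))⁻¹ * spinProd α σ * J α

theorem hamiltonian_eq {N : ℕ} (J : Finset (Fin N) → ℝ) (σ : Config N) :
    hamiltonian J σ = -(Real.sqrt N * walsh J σ) := by
  simp only [hamiltonian, walsh, Finset.mul_sum, ← Finset.sum_neg_distrib]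
  exact Finset.sum_congr rfl fun α _ => by ring

theorem card_config (N : ℕ) : Fintype.card (Config N) = 2 ^ N := by
  simp [Config]

/-- The sum over subsets factorizes over sites, and a site where the spins differ contributes the
factor `1 - 1 = 0`. -/
theorem sum_spinProd_mul {N : ℕ} (σ τ : Config N) :
    ∑ α : Finset (Fin N), spinProd α σ * spinProd α τ = if σ = τ then 2 ^ N else 0 := by
  have h : ∑ α : Finset (Fin N), spinProd α σ * spinProd α τ =
      ∏ i : Fin N, (1 + ((σ i : ℤ) : ℝ) * ((τ i : ℤ) : ℝ)) := by
    rw [Finset.prod_one_add, Finset.powerset_univ]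
    simp only [spinProd, Finset.prod_mul_distrib]
  rw [h]
  split_ifs with hst
  · subst hst
    have : ∀ i, (1 + ((σ i : ℤ) : ℝ) * ((σ i : ℤ) : ℝ)) = 2 := by
      intro i
      rcases Int.units_eq_one_or (σ i) with h | h <;> norm_num [h]
    simp [this]
  · obtain ⟨i, hi⟩ := Function.ne_iff.mp hst
    refine Finset.prod_eq_zero (Finset.mem_univ i) ?_
    rcases Int.units_eq_one_or (σ i) with h | h <;>
      rcases Int.units_eq_one_or (τ i) with h' | h' <;> simp_all

theorem walsh_gaussian {Ω : Type*} [MeasurableSpace Ω] {P : Measure Ω} [IsProbabilityMeasure P]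
    {N : ℕ} {J : Finset (Fin N) → Ω → ℝ} (hlaw : ∀ α, HasLaw (J α) (gaussianReal 0 1) P)
    (hind : iIndepFun J P) :
    (∀ σ, HasLaw (fun ω => walsh (fun α => J α ω) σ) (gaussianReal 0 1) P) ∧
      iIndepFun (fun σ ω => walsh (fun α => J α ω) σ) P := by
  refine orthonormal_image_gaussian hlaw hind
    (fun α σ => ((2 : ℝ) ^ ((N : ℝ) / 2))⁻¹ * spinProd α σ) fun σ τ => ?_
  have h2 : ((2 : ℝ) ^ ((N : ℝ) / 2)) * ((2 : ℝ) ^ ((N : ℝ) / 2)) = 2 ^ N := by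
    rw [← Real.rpow_add two_pos, add_halves, Real.rpow_natCast]
  have h3 : ∀ α : Finset (Fin N), ((2 : ℝ) ^ ((N : ℝ) / 2))⁻¹ * spinProd α σ *
      (((2 : ℝ) ^ ((N : ℝ) / 2))⁻¹ * spinProd α τ) =
      ((2 : ℝ) ^ N)⁻¹ * (spinProd α σ * spinProd α τ) := by
    intro α
    rw [← h2, mul_inv]
    ring
  simp only [h3, ← Finset.mul_sum, sum_spinProd_mul]
  split_ifs <;> simp

/-! ### Almost sure convergence of the zeta series -/

section Zeta

theorem lintegral_exp_neg_mul_expMeasure {s : ℝ} (hs : 0 < 1 + s) :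
    ∫⁻ x, ENNReal.ofReal (Real.exp (-s * x)) ∂expMeasure 1 = ENNReal.ofReal (1 / (1 + s)) := by
  have hd : expMeasure 1 = volume.withDensity (exponentialPDF 1) := rfl
  have hm : ∀ r, Measurable (exponentialPDF r) := fun r =>
    (measurable_exponentialPDFReal r).ennreal_ofReal
  rw [hd, lintegral_withDensity_eq_lintegral_mul _ (hm 1) (by fun_prop)]
  have h : ∀ x, (exponentialPDF 1 * fun x => ENNReal.ofReal (Real.exp (-s * x))) x =
      ENNReal.ofReal (1 / (1 + s)) * exponentialPDF (1 + s) x := by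
    intro x
    simp only [Pi.mul_apply, exponentialPDF_eq]
    rw [← ENNReal.ofReal_mul' (Real.exp_pos _).le, ← ENNReal.ofReal_mul (by positivity)]
    congr 1
    split_ifs
    · rw [one_mul, ← Real.exp_add, ← mul_assoc, one_div_mul_cancel hs.ne', one_mul]
      ring_nf
    · simp
  simp_rw [h]
  rw [lintegral_const_mul _ (hm _), lintegral_exponentialPDF_eq_one hs, mul_one]

/-- `∏_{ℓ ≤ j} ℓ / (ℓ + a)`. -/
noncomputable def expProd (a : ℝ) (j : ℕ) : ℝ :=
  ∏ i ∈ Finset.range j, 1 / (1 + a / ((i : ℝ) + 1))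

theorem expProd_pos {a : ℝ} (ha : 0 < a) (j : ℕ) : 0 < expProd a j :=
  Finset.prod_pos fun i _ => by positivity

/-- The terms decay like `j^{-a}`, but no asymptotics are needed: `(a - 1) expProd a (j + 1)` is the
decrement of `(j + 1) expProd a j`, so the partial sums telescope and stay below 1. -/
theorem summable_expProd {a : ℝ} (ha : 1 < a) : Summable (expProd a) := by
  have hrec : ∀ j, (a - 1) * expProd a (j + 1) =
      ((j : ℝ) + 1) * expProd a j - ((j : ℝ) + 2) * expProd a (j + 1) := by
    intro j
    have hj : (0 : ℝ) < (j : ℝ) + 1 := by positivity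
    have : (j : ℝ) + 1 + a ≠ 0 := by positivity
    rw [expProd, expProd, Finset.prod_range_succ]
    field_simp
    ring
  have htel : ∀ n, ∑ j ∈ Finset.range n, (a - 1) * expProd a (j + 1) =
      1 - ((n : ℝ) + 1) * expProd a n := by
    intro n
    induction n with
    | zero => simp [expProd]
    | succ n ih =>
      rw [Finset.sum_range_succ, ih, hrec]
      push_cast
      ring
  have h1 : Summable fun j => (a - 1) * expProd a (j + 1) := by
    refine summable_of_sum_range_le (c := 1) (fun j => ?_) fun n => ?_
    · exact mul_nonneg (by linarith) (expProd_pos (by linarith) _).le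
    · rw [htel]
      have := expProd_pos (show 0 < a by linarith) n
      have : 0 ≤ ((n : ℝ) + 1) * expProd a n := by positivity
      linarith
  rw [← summable_nat_add_iff 1]
  exact (summable_mul_left_iff (by linarith)).mp h1

variable {Ω : Type*} [MeasurableSpace Ω] {P : Measure Ω}

theorem lintegral_finsetProd_of_iIndepFun {ι : Type*} {X : ι → Ω → ENNReal}
    (hind : iIndepFun X P) (hm : ∀ i, AEMeasurable (X i) P) (s : Finset ι) :
    ∫⁻ ω, ∏ i ∈ s, X i ω ∂P = ∏ i ∈ s, ∫⁻ ω, X i ω ∂P := by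
  have h := lintegral_prod_eq_prod_lintegral_of_indepFun s (fun i => (hm i).mk (X i))
    (hind.congr fun i => (hm i).ae_eq_mk) fun i => (hm i).measurable_mk
  have h1 : ∀ᵐ ω ∂P, ∀ i ∈ s, X i ω = (hm i).mk (X i) ω :=
    (ae_ball_iff s.countable_toSet).mpr fun i _ => (hm i).ae_eq_mk
  rw [lintegral_congr_ae (h1.mono fun ω hω => Finset.prod_congr rfl hω), h]
  exact Finset.prod_congr rfl fun i _ => lintegral_congr_ae (hm i).ae_eq_mk.symm

theorem lintegral_exp_neg_mul_sum {W : ℕ → Ω → ℝ} (hlaw : ∀ i, HasLaw (W i) (expMeasure 1) P)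
    (hind : iIndepFun W P) {a : ℝ} (ha : 0 < a) (j : ℕ) :
    ∫⁻ ω, ENNReal.ofReal (Real.exp (-a * ∑ i ∈ Finset.range j, W i ω / ((i : ℝ) + 1))) ∂P =
      ENNReal.ofReal (expProd a j) := by
  let g : ℕ → ℝ → ENNReal := fun i x => ENNReal.ofReal (Real.exp (-(a / ((i : ℝ) + 1)) * x))
  have hg : ∀ i, Measurable (g i) := fun i => by fun_prop
  have h1 : ∀ ω, ENNReal.ofReal (Real.exp (-a * ∑ i ∈ Finset.range j, W i ω / ((i : ℝ) + 1))) =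
      ∏ i ∈ Finset.range j, g i (W i ω) := by
    intro ω
    simp only [g]
    rw [← ENNReal.ofReal_prod_of_nonneg fun i _ => (Real.exp_pos _).le, ← Real.exp_sum,
      Finset.mul_sum]
    congr 2
    exact Finset.sum_congr rfl fun i _ => by ring
  have h2 : ∀ i, ∫⁻ ω, g i (W i ω) ∂P = ENNReal.ofReal (1 / (1 + a / ((i : ℝ) + 1))) := by
    intro i
    rw [(hlaw i).lintegral_comp (hg i).aemeasurable]
    exact lintegral_exp_neg_mul_expMeasure (by positivity)
  simp_rw [h1]
  refine (lintegral_finsetProd_of_iIndepFun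
    (hind.comp₀ g (fun i => (hlaw i).aemeasurable) fun i => (hg i).aemeasurable)
    (fun i => (hg i).comp_aemeasurable (hlaw i).aemeasurable) (Finset.range j)).trans ?_
  simp only [Function.comp_apply, h2]
  rw [expProd, ENNReal.ofReal_prod_of_nonneg fun i _ => by positivity]

/-- By Tonelli the full series has finite expectation `∑ expProd a j`, hence is finite almost
surely. -/
theorem ae_tendsto_zetaPartial {W : ℕ → Ω → ℝ} (hlaw : ∀ i, HasLaw (W i) (expMeasure 1) P)
    (hind : iIndepFun W P) {β : ℝ} (hβ : 1 < β / betaC) :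
    ∀ᵐ ω ∂P, Tendsto (zetaPartial β fun i => W i ω) atTop (𝓝 (zeta β fun i => W i ω)) ∧
      0 ≤ zeta β fun i => W i ω := by
  set a := β / betaC with ha
  let f : ℕ → Ω → ℝ := fun j ω =>
    Real.exp (-a * ∑ i ∈ Finset.range j, W i ω / ((i : ℝ) + 1))
  have hW : ∀ i, AEMeasurable (W i) P := fun i => (hlaw i).aemeasurable
  have hm : ∀ j, AEMeasurable (fun ω => ENNReal.ofReal (f j ω)) P := fun j => by
    simp only [f]
    fun_prop
  have hfin : ∫⁻ ω, ∑' j, ENNReal.ofReal (f j ω) ∂P ≠ ⊤ := by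
    rw [lintegral_tsum hm]
    simp only [f, lintegral_exp_neg_mul_sum hlaw hind (show 0 < a by linarith)]
    exact (summable_expProd hβ).tsum_ofReal_ne_top
  filter_upwards [ae_lt_top' (AEMeasurable.tsum hm) hfin] with ω hω
  have hs : Summable fun j => f j ω := by
    have := ENNReal.summable_toReal hω.ne
    simpa [f, ENNReal.toReal_ofReal (Real.exp_pos _).le] using this
  have hz : ∀ k, zetaPartial β (fun i => W i ω) k = ∑ j ∈ Finset.Icc 2 k, f j ω := fun k => rfl
  have ht : Tendsto (zetaPartial β fun i => W i ω) atTop (𝓝 (∑' j, f (j + 2) ω)) := by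
    -- The sum over `2 ≤ j ≤ k` has `k - 1` terms, hence the shift of the range by one.
    have h := ((summable_nat_add_iff 2).mpr hs).hasSum.tendsto_sum_nat.comp
      (tendsto_sub_atTop_nat 1)
    refine h.congr fun k => ?_
    rw [hz]
    simp only [Function.comp_apply]
    rw [Finset.range_eq_Ico, Finset.sum_Ico_add' (fun j => f j ω)]
    refine Finset.sum_congr ?_ fun _ _ => rfl
    ext j
    simp only [Finset.mem_Ico, Finset.mem_Icc]
    omega
  rw [zeta, ht.limUnder_eq]
  exact ⟨ht, tsum_nonneg fun j => (Real.exp_pos _).le⟩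

end Zeta

/-! ### Gaussian tail estimates -/

section Tails

/-- The truncated exponential weight `min(1, e^{b(y-x)})`. -/
noncomputable def truncWeight (b x y : ℝ) : ℝ := min 1 (Real.exp (b * (y - x)))

theorem truncWeight_nonneg (b x y : ℝ) : 0 ≤ truncWeight b x y :=
  le_min zero_le_one (Real.exp_pos _).le

theorem truncWeight_le_one (b x y : ℝ) : truncWeight b x y ≤ 1 := min_le_left _ _

@[fun_prop]
theorem measurable_truncWeight (b x : ℝ) : Measurable (truncWeight b x) := by
  unfold truncWeight
  fun_prop

/-- The concave exponent `-y²/2` lies below its tangent at `x`; the normalizing constant is at most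
1. -/
theorem gaussianPDFReal_le (x y : ℝ) :
    gaussianPDFReal 0 1 y ≤ Real.exp (-x ^ 2 / 2) * Real.exp (-x * (y - x)) := by
  have h1 : (√(2 * Real.pi * ((1 : NNReal) : ℝ)))⁻¹ ≤ 1 := by
    refine inv_le_one_of_one_le₀ (Real.one_le_sqrt.mpr ?_)
    have := Real.pi_gt_three
    simp only [NNReal.coe_one]
    linarith
  rw [gaussianPDFReal, ← Real.exp_add]
  refine (mul_le_of_le_one_left (Real.exp_pos _).le h1).trans (Real.exp_le_exp.mpr ?_)
  simp only [NNReal.coe_one]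
  nlinarith [sq_nonneg (y - x)]

/-- With the tangent bound, the integrand decays at rate `x` above the level and, because `b > x`,
at rate `b - x` below it; each side contributes one reciprocal. -/
theorem lintegral_truncWeight_le {b x : ℝ} (hx : 0 < x) (hb : x < b) :
    ∫⁻ y, ENNReal.ofReal (truncWeight b x y) ∂gaussianReal 0 1 ≤
      ENNReal.ofReal (Real.exp (-x ^ 2 / 2) * (1 / x + 1 / (b - x))) := by
  have hbx : 0 < b - x := sub_pos.mpr hb
  rw [gaussianReal_of_var_ne_zero _ one_ne_zero,
    lintegral_withDensity_eq_lintegral_mul _ (measurable_gaussianPDF 0 1) (by fun_prop),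
    ← lintegral_add_compl _ (measurableSet_Ioi (a := x)), Set.compl_Ioi, mul_add,
    ENNReal.ofReal_add (by positivity) (by positivity)]
  have hpt : ∀ y, (gaussianPDF 0 1 * fun y => ENNReal.ofReal (truncWeight b x y)) y =
      ENNReal.ofReal (gaussianPDFReal 0 1 y * truncWeight b x y) := fun y => by
    rw [Pi.mul_apply, gaussianPDF, ENNReal.ofReal_mul (gaussianPDFReal_nonneg _ _ _)]
  simp_rw [hpt]
  refine add_le_add ?_ ?_
  · calc _ ≤ ∫⁻ y in Set.Ioi x, ENNReal.ofReal (Real.exp (x ^ 2 / 2) * Real.exp (-x * y)) := by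
          refine lintegral_mono fun y => ENNReal.ofReal_le_ofReal ?_
          refine (mul_le_of_le_one_right (gaussianPDFReal_nonneg _ _ _)
            (truncWeight_le_one _ _ _)).trans ((gaussianPDFReal_le x y).trans_eq ?_)
          rw [← Real.exp_add, ← Real.exp_add]
          ring_nf
      _ = ENNReal.ofReal (∫ y in Set.Ioi x, Real.exp (x ^ 2 / 2) * Real.exp (-x * y)) := by
          refine (ofReal_integral_eq_lintegral_ofReal ?_ ?_).symm
          · exact (integrableOn_exp_mul_Ioi (by linarith) x).const_mul _
          · exact .of_forall fun y => by positivity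
      _ ≤ _ := by
          rw [integral_const_mul, integral_exp_mul_Ioi (by linarith)]
          refine ENNReal.ofReal_le_ofReal (le_of_eq ?_)
          rw [neg_div_neg_eq, ← mul_div_assoc, ← Real.exp_add, mul_one_div]
          ring_nf
  · calc _ ≤ ∫⁻ y in Set.Iic x, ENNReal.ofReal
            (Real.exp (x ^ 2 / 2 - b * x) * Real.exp ((b - x) * y)) := by
          refine lintegral_mono fun y => ENNReal.ofReal_le_ofReal ?_
          refine (mul_le_mul (gaussianPDFReal_le x y) (min_le_right _ _) (truncWeight_nonneg _ _ _)
            (by positivity)).trans_eq ?_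
          rw [← Real.exp_add, ← Real.exp_add, ← Real.exp_add]
          ring_nf
      _ = ENNReal.ofReal (∫ y in Set.Iic x,
            Real.exp (x ^ 2 / 2 - b * x) * Real.exp ((b - x) * y)) := by
          refine (ofReal_integral_eq_lintegral_ofReal ?_ ?_).symm
          · exact (integrableOn_exp_mul_Iic hbx x).const_mul _
          · exact .of_forall fun y => by positivity
      _ ≤ _ := by
          rw [integral_const_mul, integral_exp_mul_Iic hbx]
          refine ENNReal.ofReal_le_ofReal (le_of_eq ?_)
          rw [← mul_div_assoc, ← Real.exp_add, mul_one_div]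
          ring_nf

theorem le_gaussianReal_Ioi {x h : ℝ} (hx : 0 ≤ x) :
    h * ((√(2 * Real.pi))⁻¹ * Real.exp (-(x + h) ^ 2 / 2)) ≤
      (gaussianReal 0 1).real (Set.Ioi x) := by
  have h1 : ENNReal.ofReal (h * ((√(2 * Real.pi))⁻¹ * Real.exp (-(x + h) ^ 2 / 2))) ≤
      gaussianReal 0 1 (Set.Ioi x) := by
    calc _ = ∫⁻ _ in Set.Ioc x (x + h),
          ENNReal.ofReal ((√(2 * Real.pi))⁻¹ * Real.exp (-(x + h) ^ 2 / 2)) := by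
          rw [setLIntegral_const, Real.volume_Ioc, add_sub_cancel_left, mul_comm h,
            ENNReal.ofReal_mul (by positivity)]
      _ ≤ ∫⁻ y in Set.Ioc x (x + h), gaussianPDF 0 1 y := by
          refine setLIntegral_mono (measurable_gaussianPDF 0 1) fun y hy => ?_
          rw [gaussianPDF, gaussianPDFReal]
          refine ENNReal.ofReal_le_ofReal ?_
          simp only [NNReal.coe_one, mul_one, sub_zero]
          gcongr
          · linarith [hy.1]
          · exact hy.2
      _ ≤ ∫⁻ y in Set.Ioi x, gaussianPDF 0 1 y :=
          lintegral_mono_set Set.Ioc_subset_Ioi_self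
      _ = _ := (gaussianReal_apply 0 one_ne_zero _).symm
  exact (ENNReal.ofReal_le_iff_le_toReal (measure_ne_top _ _)).mp h1

end Tails

/-! ### Concentration for independent variables -/

section Concentration

variable {Ω : Type*} [MeasurableSpace Ω] {P : Measure Ω} {ι : Type*} [Fintype ι]

/-- Chernoff bound at parameter 1: convexity gives `e^y ≤ 1 + 2y` on `[0, 1]`, so each moment
generating factor is at most `e^{2q}`. -/
theorem measureReal_sum_ge_le [IsProbabilityMeasure P] {Y : ι → Ω → ℝ} (hind : iIndepFun Y P)
    (hm : ∀ i, AEMeasurable (Y i) P) (h0 : ∀ i ω, 0 ≤ Y i ω) (h1 : ∀ i ω, Y i ω ≤ 1)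
    {q : ℝ} (hq : ∀ i, ∫ ω, Y i ω ∂P ≤ q) (t : ℝ) :
    P.real {ω | t ≤ ∑ i, Y i ω} ≤ Real.exp (2 * (Fintype.card ι * q) - t) := by
  have hint : ∀ i, Integrable (Y i) P := fun i =>
    Integrable.of_bound (hm i).aestronglyMeasurable 1 (.of_forall fun ω => by
      rw [Real.norm_eq_abs, abs_of_nonneg (h0 i ω)]
      exact h1 i ω)
  have hexp : ∀ y : ℝ, 0 ≤ y → y ≤ 1 → Real.exp y ≤ 1 + 2 * y := by
    intro y hy0 hy1
    have hc := convexOn_exp.2 (Set.mem_univ 0) (Set.mem_univ 1) (sub_nonneg.mpr hy1) hy0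
      (by ring)
    simp only [smul_eq_mul, mul_zero, mul_one, zero_add, Real.exp_zero] at hc
    nlinarith [Real.exp_one_lt_d9]
  have hmgf : ∀ i, mgf (Y i) P 1 ≤ Real.exp (2 * q) := by
    intro i
    calc mgf (Y i) P 1 ≤ ∫ ω, (1 + 2 * Y i ω) ∂P := by
          rw [mgf]
          refine integral_mono_of_nonneg (.of_forall fun ω => (Real.exp_pos _).le)
            ((integrable_const _).add ((hint i).const_mul _)) (.of_forall fun ω => ?_)
          simpa using hexp _ (h0 i ω) (h1 i ω)
      _ = 1 + 2 * ∫ ω, Y i ω ∂P := by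
          rw [integral_add (integrable_const _) ((hint i).const_mul _), integral_const_mul]
          simp
      _ ≤ 2 * q + 1 := by linarith [hq i]
      _ ≤ _ := Real.add_one_le_exp _
  have hS : ∀ ω, (∑ i, Y i) ω = ∑ i, Y i ω := fun ω => by simp
  have hint' : Integrable (fun ω => Real.exp (1 * (∑ i, Y i) ω)) P := by
    refine Integrable.of_bound ?_ (Real.exp (Fintype.card ι)) (.of_forall fun ω => ?_)
    · have : AEMeasurable (∑ i, Y i) P := Finset.aemeasurable_sum _ fun i _ => hm i
      exact (Real.measurable_exp.comp_aemeasurable (this.const_mul 1)).aestronglyMeasurable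
    · rw [Real.norm_eq_abs, Real.abs_exp, one_mul, hS]
      refine Real.exp_le_exp.mpr ((Finset.sum_le_sum fun i _ => h1 i ω).trans_eq ?_)
      simp
  have := measure_ge_le_exp_mul_mgf (μ := P) t zero_le_one hint'
  simp only [hS] at this
  refine this.trans ?_
  rw [hind.mgf_sum₀ hm]
  calc _ ≤ Real.exp (-1 * t) * ∏ _i : ι, Real.exp (2 * q) := by
        gcongr with i
        · exact fun i _ => mgf_nonneg
        · exact hmgf i
    _ = _ := by
        rw [Finset.prod_const, Finset.card_univ, ← Real.exp_nat_mul, ← Real.exp_add]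
        ring_nf

theorem measureReal_forall_le_le {X : ι → Ω → ℝ} {μ : Measure ℝ} [IsProbabilityMeasure μ]
    (hlaw : ∀ i, HasLaw (X i) μ P) (hind : iIndepFun X P) (x : ℝ) :
    P.real {ω | ∀ i, X i ω ≤ x} ≤ Real.exp (-(Fintype.card ι * μ.real (Set.Ioi x))) := by
  have h := hind.measure_inter_preimage_eq_mul Finset.univ (sets := fun _ => Set.Iic x)
    fun _ _ => measurableSet_Iic
  have hset : {ω | ∀ i, X i ω ≤ x} = ⋂ i ∈ Finset.univ, X i ⁻¹' Set.Iic x := by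
    ext ω
    simp
  have hp : ∀ i, P (X i ⁻¹' Set.Iic x) = μ (Set.Iic x) := fun i =>
    (hlaw i).measure_eq (p := fun y => y ≤ x) measurableSet_Iic
  rw [hset, measureReal_def, h]
  simp only [hp, Finset.prod_const, Finset.card_univ, ENNReal.toReal_pow]
  have hc : (μ (Set.Iic x)).toReal = 1 - μ.real (Set.Ioi x) := by
    rw [← Set.compl_Ioi, ← measureReal_def, probReal_compl_eq_one_sub measurableSet_Ioi]
  rw [hc, ← mul_neg, Real.exp_nat_mul]
  refine pow_le_pow_left₀ (sub_nonneg.mpr measureReal_le_one) ?_ _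
  linarith [Real.add_one_le_exp (-μ.real (Set.Ioi x))]

end Concentration

/-! ### Total variation distance -/

section TotalVariation

variable {N : ℕ}

theorem abs_integral_sub_le (μ ν : Measure (Config N)) [IsProbabilityMeasure μ]
    [IsProbabilityMeasure ν] {Ψ : Config N → ℝ} (hΨ : ‖Ψ‖ = 1) :
    |∫ σ, Ψ σ ∂μ - ∫ σ, Ψ σ ∂ν| ≤ 2 := by
  have h : ∀ (ρ : Measure (Config N)) [IsProbabilityMeasure ρ], |∫ σ, Ψ σ ∂ρ| ≤ 1 := by
    intro ρ _
    have := norm_integral_le_of_norm_le_const (μ := ρ) (f := Ψ) (C := 1)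
      (.of_forall fun σ => (norm_le_pi_norm Ψ σ).trans_eq hΨ)
    simpa using this
  have h1 := abs_le.mp (h μ)
  have h2 := abs_le.mp (h ν)
  exact abs_le.mpr ⟨by linarith, by linarith⟩

theorem dTV_le_two (μ ν : Measure (Config N)) [IsProbabilityMeasure μ] [IsProbabilityMeasure ν] :
    dTV μ ν ≤ 2 := by
  refine Real.sSup_le ?_ zero_le_two
  rintro d ⟨Ψ, hΨ, rfl⟩
  exact abs_integral_sub_le μ ν hΨ

theorem dTV_self (μ : Measure (Config N)) : dTV μ μ ≤ 0 := by
  refine Real.sSup_le ?_ le_rfl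
  rintro d ⟨Ψ, -, rfl⟩
  simp

theorem two_mul_sub_le_dTV (μ ν : Measure (Config N)) [IsProbabilityMeasure μ]
    [IsProbabilityMeasure ν] (A : Set (Config N)) :
    2 * (μ.real A - ν.real A) ≤ dTV μ ν := by
  classical
  have hA : MeasurableSet A := A.toFinite.measurableSet
  -- The sign function of `A` has sup norm exactly 1 and yields the factor 2.
  let Ψ : Config N → ℝ := fun σ => A.indicator (fun _ => 2) σ - 1
  have habs : ∀ σ, ‖Ψ σ‖ = 1 := by
    intro σ
    by_cases h : σ ∈ A <;> (simp [Ψ, h]; try norm_num)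
  have hΨ : ‖Ψ‖ = 1 := by
    refine le_antisymm ((pi_norm_le_iff_of_nonneg zero_le_one).mpr fun σ => (habs σ).le) ?_
    exact (habs 1).symm.le.trans (norm_le_pi_norm Ψ 1)
  have hint : ∀ (ρ : Measure (Config N)) [IsProbabilityMeasure ρ],
      ∫ σ, Ψ σ ∂ρ = 2 * ρ.real A - 1 := by
    intro ρ _
    simp only [Ψ]
    rw [integral_sub (.of_finite) (.of_finite), integral_indicator_const _ hA]
    simp [mul_comm]
  have hbdd : BddAbove {d : ℝ | ∃ Ψ : Config N → ℝ, ‖Ψ‖ = 1 ∧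
      d = |∫ σ, Ψ σ ∂μ - ∫ σ, Ψ σ ∂ν|} := by
    refine ⟨2, ?_⟩
    rintro d ⟨Ψ, hΨ, rfl⟩
    exact abs_integral_sub_le μ ν hΨ
  refine le_trans ?_ (le_csSup hbdd ⟨Ψ, hΨ, rfl⟩)
  rw [hint, hint]
  refine le_trans (le_of_eq ?_) (le_abs_self _)
  ring

end TotalVariation

/-! ### Gibbs and uniform measures in finite volume -/

section FiniteVolume

variable {N : ℕ} (H : Config N → ℝ) (β : ℝ)

theorem partitionFn_pos : 0 < partitionFn H β :=
  Finset.sum_pos (fun _ _ => Real.exp_pos _) Finset.univ_nonempty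

open Classical in
theorem gibbs_apply (A : Set (Config N)) :
    gibbs H β A =
      ENNReal.ofReal ((∑ σ with σ ∈ A, Real.exp (-β * H σ)) / partitionFn H β) := by
  have hZ := partitionFn_pos H β
  rw [gibbs, Measure.finsetSum_apply, Finset.sum_div, Finset.sum_filter,
    ENNReal.ofReal_sum_of_nonneg]
  · refine Finset.sum_congr rfl fun σ _ => ?_
    rw [Measure.smul_apply, Measure.dirac_apply]
    by_cases h : σ ∈ A <;> simp [h]
  · intro σ _
    split_ifs <;> positivity

instance isProbabilityMeasure_gibbs : IsProbabilityMeasure (gibbs H β) := by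
  classical
  refine ⟨?_⟩
  rw [gibbs_apply]
  simp only [Set.mem_univ, Finset.filter_true]
  rw [← partitionFn, div_self (partitionFn_pos H β).ne', ENNReal.ofReal_one]

open Classical in
theorem gibbs_real_apply (A : Set (Config N)) :
    (gibbs H β).real A = (∑ σ with σ ∈ A, Real.exp (-β * H σ)) / partitionFn H β := by
  rw [measureReal_def, gibbs_apply, ENNReal.toReal_ofReal]
  have := partitionFn_pos H β
  positivity

theorem sortedConfig_injective : Function.Injective (sortedConfig H) := by
  intro i j h
  simpa [sortedConfig] using h

theorem ncard_lowest (k : ℕ) : (lowest H k).ncard = min k (2 ^ N) := by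
  rw [lowest, Set.ncard_image_of_injective _ (sortedConfig_injective H),
    Set.ncard_eq_toFinset_card', ← card_config N, Set.toFinset_ofPred, Fin.card_filter_val_lt]
  exact min_comm _ _

theorem isProbabilityMeasure_uniformLowest {k : ℕ} (hk : 0 < k) :
    IsProbabilityMeasure (uniformLowest H k) := by
  refine isProbabilityMeasure_uniformOn (Set.toFinite _) ?_
  rw [← Set.ncard_pos, ncard_lowest]
  positivity

theorem uniformLowest_real_le (k : ℕ) (A : Set (Config N)) :
    (uniformLowest H k).real A ≤ A.ncard / ((min k (2 ^ N) : ℕ) : ℝ) := by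
  classical
  have h : (uniformLowest H k) A =
      ((lowest H k).toFinset ∩ A.toFinset).card / (lowest H k).toFinset.card := by
    rw [← uniformOn_apply_finset]
    simp [uniformLowest]
  rw [measureReal_def, h, ENNReal.toReal_div, ENNReal.toReal_natCast, ENNReal.toReal_natCast,
    ← Set.ncard_eq_toFinset_card', ncard_lowest, Set.ncard_eq_toFinset_card' A]
  gcongr
  exact Finset.inter_subset_right

/-- If some configuration lies above level `x'`, the Gibbs measure is mostly carried by the
configurations above level `x`, which are too few for the uniform measure to see them. -/
theorem dTV_gibbs_uniformLowest_ge {H : Config N → ℝ} {β s x x' : ℝ} {X : Config N → ℝ}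
    (hH : ∀ σ, -β * H σ = s * X σ) (hs : 0 ≤ s) {σ₀ : Config N} (hσ₀ : x' < X σ₀) {k : ℕ}
    (hk : 0 < k) :
    2 * (1 - (∑ σ, truncWeight s x (X σ)) * Real.exp (-(s * (x' - x))) -
        (∑ σ, truncWeight s x (X σ)) / ((min k (2 ^ N) : ℕ) : ℝ)) ≤
      dTV (gibbs H β) (uniformLowest H k) := by
  classical
  have := isProbabilityMeasure_uniformLowest H hk
  set S := ∑ σ, truncWeight s x (X σ)
  let A : Set (Config N) := {σ | x < X σ}
  have hcard : (A.ncard : ℝ) ≤ S := by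
    rw [Set.ncard_eq_toFinset_card', Finset.card_eq_sum_ones, Nat.cast_sum]
    refine (Finset.sum_le_sum fun σ hσ => ?_).trans
      (Finset.sum_le_univ_sum_of_nonneg fun σ => truncWeight_nonneg s x (X σ))
    have hx : x < X σ := by simpa [A] using hσ
    rw [truncWeight, min_eq_left, Nat.cast_one]
    exact Real.one_le_exp (mul_nonneg hs (by linarith))
  have hgood : (gibbs H β).real Aᶜ ≤ S * Real.exp (-(s * (x' - x))) := by
    rw [gibbs_real_apply, div_le_iff₀ (partitionFn_pos H β)]
    -- The single configuration `σ₀` already bounds the partition function from below.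
    have hZ : Real.exp (s * x') ≤ partitionFn H β := by
      refine le_trans ?_ (Finset.single_le_sum (f := fun σ => Real.exp (-β * H σ))
        (fun σ _ => (Real.exp_pos _).le) (Finset.mem_univ σ₀))
      simp only [hH]
      gcongr
    have hS : 0 ≤ S := Finset.sum_nonneg fun σ _ => truncWeight_nonneg s x (X σ)
    refine (Finset.sum_le_sum (g := fun σ => truncWeight s x (X σ) * Real.exp (s * x))
      fun σ hσ => ?_).trans ?_
    · have hx : X σ ≤ x := by simpa [A] using hσ
      rw [truncWeight, min_eq_right, ← Real.exp_add, hH]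
      · exact (congrArg Real.exp (by ring)).le
      · exact Real.exp_le_one_iff.mpr (mul_nonpos_of_nonneg_of_nonpos hs (by linarith))
    · calc _ ≤ S * Real.exp (s * x) := by
            rw [← Finset.sum_mul]
            gcongr
            exact Finset.sum_le_univ_sum_of_nonneg fun σ => truncWeight_nonneg s x (X σ)
        _ = S * Real.exp (-(s * (x' - x))) * Real.exp (s * x') := by
            rw [mul_assoc, ← Real.exp_add]
            ring_nf
        _ ≤ _ := by gcongr
  rw [probReal_compl_eq_one_sub A.toFinite.measurableSet] at hgood
  have hunif := (uniformLowest_real_le H k A).trans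
    (div_le_div_of_nonneg_right hcard (Nat.cast_nonneg _))
  linarith [two_mul_sub_le_dTV (gibbs H β) (uniformLowest H k) A]

end FiniteVolume

theorem betaC_pos : 0 < betaC := Real.sqrt_pos.mpr (by positivity)

theorem betaC_sq : betaC ^ 2 = 2 * Real.log 2 := Real.sq_sqrt (by positivity)

/-! ### Energy levels near the ground state -/

section Levels

/-- The level above which the expected number of the `2^N` standard Gaussian variables is of
order `N^{p - 1/2}`. -/
noncomputable def level (p : ℝ) (N : ℕ) : ℝ :=
  betaC * √N - p * Real.log N / (betaC * √N)

theorem two_pow_mul_exp {N : ℕ} (hN : 0 < N) (p r : ℝ) :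
    (2 : ℝ) ^ N * Real.exp (-(N * Real.log 2 - p * Real.log N + r)) =
      (N : ℝ) ^ p * Real.exp (-r) := by
  have hN' : (0 : ℝ) < N := Nat.cast_pos.mpr hN
  rw [Real.rpow_def_of_pos hN', ← Real.rpow_natCast 2 N, Real.rpow_def_of_pos two_pos,
    ← Real.exp_add, ← Real.exp_add]
  ring_nf

theorem level_add_sq {N : ℕ} (hN : 0 < N) (p e : ℝ) :
    (level p N + e / √N) ^ 2 / 2 = N * Real.log 2 - p * Real.log N +
      (betaC * e + (p * Real.log N / betaC - e) ^ 2 / N / 2) := by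
  have hN' : (0 : ℝ) < N := Nat.cast_pos.mpr hN
  have hs : 0 < √(N : ℝ) := Real.sqrt_pos.mpr hN'
  have hc := betaC_pos
  have h1 : level p N + e / √N = betaC * √N - (p * Real.log N / betaC - e) / √N := by
    rw [level]
    field_simp
    ring
  have h2 : (N : ℝ) * Real.log 2 = (betaC * √N) ^ 2 / 2 := by
    rw [mul_pow, betaC_sq, Real.sq_sqrt hN'.le]
    ring
  have h3 : ((p * Real.log N / betaC - e) / √N) ^ 2 = (p * Real.log N / betaC - e) ^ 2 / N := by
    rw [div_pow, Real.sq_sqrt hN'.le]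
  have h4 : betaC * √N * ((p * Real.log N / betaC - e) / √N) = p * Real.log N - betaC * e := by
    field_simp
  rw [h1, h2, ← h3]
  linear_combination -h4

theorem two_pow_mul_exp_level_le {N : ℕ} (hN : 0 < N) (p : ℝ) :
    (2 : ℝ) ^ N * Real.exp (-level p N ^ 2 / 2) ≤ (N : ℝ) ^ p := by
  have h := level_add_sq hN p 0
  rw [zero_div, add_zero, mul_zero, zero_add, sub_zero] at h
  rw [neg_div, h, two_pow_mul_exp hN]
  refine mul_le_of_le_one_right (by positivity) (Real.exp_le_one_iff.mpr ?_)
  rw [neg_nonpos]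
  positivity

theorem tendsto_log_mul_div_sqrt (r : ℝ) :
    Tendsto (fun N : ℕ => r * Real.log N / √N) atTop (𝓝 0) := by
  have h := ((isLittleO_log_rpow_atTop (show (0 : ℝ) < 1 / 2 by norm_num)).tendsto_div_nhds_zero.comp
    (tendsto_natCast_atTop_atTop (R := ℝ))).const_mul r
  rw [mul_zero] at h
  refine h.congr fun N => ?_
  rw [Function.comp_apply, Real.sqrt_eq_rpow, mul_div_assoc]

theorem tendsto_sqrt_natCast : Tendsto (fun N : ℕ => √(N : ℝ)) atTop atTop :=
  Real.tendsto_sqrt_atTop.comp tendsto_natCast_atTop_atTop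

theorem eventually_le_level (p : ℝ) : ∀ᶠ N : ℕ in atTop, betaC / 2 * √N ≤ level p N := by
  have hc := betaC_pos
  filter_upwards [(tendsto_log_mul_div_sqrt (p / betaC)).eventually_le_const
      (show (0 : ℝ) < betaC / 2 by positivity),
    tendsto_sqrt_natCast.eventually_ge_atTop 1] with N h1 h2
  have h3 : p * Real.log N / (betaC * √N) = p / betaC * Real.log N / √N := by
    field_simp
  rw [level, h3]
  nlinarith

/-- A window of width `1/√N` above the level suffices: its width costs `N^{-1/2}`, the density drops
across it by a factor of about `e^{-β_c}`, and the extra 1 in the exponent absorbs the vanishing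
quadratic error. -/
theorem le_two_pow_mul_gaussianReal_level (p : ℝ) : ∀ᶠ N : ℕ in atTop,
    (√(2 * Real.pi))⁻¹ * Real.exp (-(betaC + 1)) * (N : ℝ) ^ (p - 1 / 2) ≤
      2 ^ N * (gaussianReal 0 1).real (Set.Ioi (level p N)) := by
  have hc := betaC_pos
  have hlim : Tendsto (fun N : ℕ => p / betaC * Real.log N / √N - 1 / √N) atTop (𝓝 0) := by
    simpa using (tendsto_log_mul_div_sqrt (p / betaC)).sub
      ((tendsto_const_nhds (x := (1 : ℝ))).div_atTop tendsto_sqrt_natCast)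
  have hlim2 := hlim.pow 2
  rw [zero_pow two_ne_zero] at hlim2
  filter_upwards [hlim2.eventually_le_const (show (0 : ℝ) < 2 by norm_num),
    eventually_le_level p, eventually_gt_atTop 0] with N h1 h2 hN
  have hN' : (0 : ℝ) < N := Nat.cast_pos.mpr hN
  have hs : 0 < √(N : ℝ) := Real.sqrt_pos.mpr hN'
  have h3 : (p * Real.log N / betaC - 1) ^ 2 / N ≤ 2 := by
    refine le_trans (le_of_eq ?_) h1
    rw [← sub_div, div_pow, Real.sq_sqrt hN'.le, div_mul_eq_mul_div]
  have h4 := le_gaussianReal_Ioi (h := 1 / √N) ((by positivity : 0 ≤ betaC / 2 * √N).trans h2)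
  refine le_trans ?_ (mul_le_mul_of_nonneg_left h4 (by positivity))
  have h5 : (2 : ℝ) ^ N * Real.exp (-(level p N + 1 / √N) ^ 2 / 2) ≥
      (N : ℝ) ^ p * Real.exp (-(betaC + 1)) := by
    rw [neg_div, level_add_sq hN, two_pow_mul_exp hN]
    have h7 : (p * Real.log N / betaC - 1) ^ 2 / N / 2 ≤ 1 := by linarith
    gcongr
    linarith
  have h6 : (N : ℝ) ^ (p - 1 / 2) = (N : ℝ) ^ p * (1 / √N) := by
    rw [Real.rpow_sub hN', Real.sqrt_eq_rpow, mul_one_div]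
  rw [h6]
  calc _ = 1 / √N * (√(2 * Real.pi))⁻¹ * ((N : ℝ) ^ p * Real.exp (-(betaC + 1))) := by ring
    _ ≤ 1 / √N * (√(2 * Real.pi))⁻¹ *
        ((2 : ℝ) ^ N * Real.exp (-(level p N + 1 / √N) ^ 2 / 2)) := by gcongr
    _ = _ := by ring

/-- At this level `2^N e^{-x²/2} ≤ N`, while `x` and `β√N - x` are both at least of order `√N`. -/
theorem two_pow_mul_integral_truncWeight_le {β : ℝ} (hβ : betaC < β) : ∀ᶠ N : ℕ in atTop,
    (2 : ℝ) ^ N * ∫ y, truncWeight (β * √N) (level 1 N) y ∂gaussianReal 0 1 ≤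
      (2 / betaC + 1 / (β - betaC)) * √N := by
  have hc := betaC_pos
  filter_upwards [eventually_le_level 1, eventually_gt_atTop 0] with N h1 hN
  have hN' : (0 : ℝ) < N := Nat.cast_pos.mpr hN
  have hs : 0 < √(N : ℝ) := Real.sqrt_pos.mpr hN'
  have hx : 0 < level 1 N := lt_of_lt_of_le (by positivity) h1
  have hxb : (β - betaC) * √N ≤ β * √N - level 1 N := by
    have h0 : 0 ≤ 1 * Real.log N / (betaC * √N) := by
      have := Real.log_natCast_nonneg N
      positivity
    rw [level]
    linarith
  have hβ' : 0 < β - betaC := sub_pos.mpr hβ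
  have hxb' : 0 < β * √N - level 1 N := lt_of_lt_of_le (by positivity) hxb
  have hint : ∫ y, truncWeight (β * √N) (level 1 N) y ∂gaussianReal 0 1 ≤
      Real.exp (-level 1 N ^ 2 / 2) * (1 / level 1 N + 1 / (β * √N - level 1 N)) := by
    rw [integral_eq_lintegral_of_nonneg_ae (.of_forall fun y => truncWeight_nonneg _ _ y)
      (measurable_truncWeight _ _).aestronglyMeasurable]
    exact ENNReal.toReal_le_of_le_ofReal (by positivity)
      (lintegral_truncWeight_le hx (by linarith))
  calc _ ≤ (2 : ℝ) ^ N * (Real.exp (-level 1 N ^ 2 / 2) *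
        (1 / level 1 N + 1 / (β * √N - level 1 N))) := by gcongr
    _ = (2 : ℝ) ^ N * Real.exp (-level 1 N ^ 2 / 2) *
        (1 / level 1 N + 1 / (β * √N - level 1 N)) := by ring
    _ ≤ (N : ℝ) ^ (1 : ℝ) * (1 / (betaC / 2 * √N) + 1 / ((β - betaC) * √N)) := by
        gcongr
        exact two_pow_mul_exp_level_le hN 1
    _ = (√N * √N) * (1 / (betaC / 2 * √N) + 1 / ((β - betaC) * √N)) := by
        rw [Real.rpow_one, Real.mul_self_sqrt hN'.le]
    _ = _ := by field_simp

end Levels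

/-! ### Borel–Cantelli with stretched exponential bounds -/

section BorelCantelli

theorem summable_exp_neg_mul_rpow {c γ : ℝ} (hc : 0 < c) (hγ : 0 < γ) :
    Summable fun N : ℕ => Real.exp (-c * (N : ℝ) ^ γ) := by
  -- The exponent `-2/γ`, evaluated at `N^γ`, gives the summable comparison `N^{-2}`.
  have h := (isLittleO_exp_neg_mul_rpow_atTop hc (-2 / γ)).comp_tendsto
    ((tendsto_rpow_atTop hγ).comp (tendsto_natCast_atTop_atTop (R := ℝ)))
  refine summable_of_isBigO_nat (Real.summable_nat_rpow.mpr (show (-2 : ℝ) < -1 by norm_num))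
    (h.isBigO.congr' EventuallyEq.rfl (.of_forall fun N => ?_))
  simp only [Function.comp_apply]
  rw [← Real.rpow_mul (Nat.cast_nonneg _), mul_div_cancel₀ _ hγ.ne']

theorem ae_eventually_notMem_of_exp_bound {Ω : Type*} [MeasurableSpace Ω] {P : Measure Ω}
    [IsProbabilityMeasure P] {s : ℕ → Set Ω} {c γ : ℝ} (hc : 0 < c) (hγ : 0 < γ)
    (h : ∀ᶠ N : ℕ in atTop, P.real (s N) ≤ Real.exp (-c * (N : ℝ) ^ γ)) :
    ∀ᵐ ω ∂P, ∀ᶠ N in atTop, ω ∉ s N := by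
  refine ae_eventually_notMem ?_
  have hs : Summable fun N => P.real (s N) :=
    (summable_exp_neg_mul_rpow hc hγ).of_norm_bounded_eventually_nat
      (h.mono fun N hN => by rwa [Real.norm_of_nonneg measureReal_nonneg])
  simpa [measureReal_def] using hs.tsum_ofReal_ne_top

end BorelCantelli

theorem ae_eventually_one_le_dTV {Ω : Type*} [MeasurableSpace Ω] {P : Measure Ω}
    [IsProbabilityMeasure P] {J : (N : ℕ) → Finset (Fin N) → Ω → ℝ}
    (hJ_law : ∀ N α, HasLaw (J N α) (gaussianReal 0 1) P) (hJ_indep : ∀ N, iIndepFun (J N) P)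
    {β : ℝ} (hβ : betaC < β) {k : ℕ → ℕ}
    (hk : Tendsto (fun N : ℕ => (k N : ℝ) / N) atTop atTop) :
    ∀ᵐ ω ∂P, ∀ᶠ N : ℕ in atTop, 0 < k N ∧
      1 ≤ dTV (gibbs (hamiltonian fun α => J N α ω) β)
        (uniformLowest (hamiltonian fun α => J N α ω) (k N)) := by
  have hc := betaC_pos
  have hβ' : 0 < β - betaC := sub_pos.mpr hβ
  set a := β / betaC with ha
  have ha1 : 1 < a := (one_lt_div hc).mpr hβ
  -- This choice makes `1/2 - a(1/2 - γ) = (1 - a)/4`, the power of `N` bounding the Gibbs mass off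
  -- `A`, negative.
  set γ := (1 - 1 / a) / 4 with hγdef
  have hγ : 0 < γ := by
    have : 1 / a < 1 := (div_lt_one (by linarith)).mpr ha1
    rw [hγdef]
    linarith
  have hexp : 1 / 2 - a * (1 / 2 - γ) < 0 := by
    have : a * (1 / 2 - γ) = a / 4 + 1 / 4 := by
      rw [hγdef]
      field_simp
      ring
    linarith
  set C := 2 / betaC + 1 / (β - betaC) with hC
  have hCpos : 0 < C := by positivity
  let X : (N : ℕ) → Config N → Ω → ℝ := fun N σ ω => walsh (fun α => J N α ω) σ
  have hX : ∀ N σ, HasLaw (X N σ) (gaussianReal 0 1) P := fun N =>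
    (walsh_gaussian (hJ_law N) (hJ_indep N)).1
  have hXind : ∀ N, iIndepFun (X N) P := fun N => (walsh_gaussian (hJ_law N) (hJ_indep N)).2
  let S : ℕ → Ω → ℝ := fun N ω => ∑ σ, truncWeight (β * √N) (level 1 N) (X N σ ω)
  -- The mean of `S` is at most `C√N`, which costs `e^{2C√N}` in the Chernoff bound; the threshold
  -- `4C√N` leaves `e^{-2C√N}`.
  have hS : ∀ᵐ ω ∂P, ∀ᶠ N : ℕ in atTop, ω ∉ {ω | 4 * C * √N ≤ S N ω} := by
    refine ae_eventually_notMem_of_exp_bound (c := 2 * C) (γ := 1 / 2) (by positivity)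
      (by norm_num) ?_
    filter_upwards [two_pow_mul_integral_truncWeight_le hβ] with N hN
    have h := measureReal_sum_ge_le
      (Y := fun σ ω => truncWeight (β * √N) (level 1 N) (X N σ ω))
      ((hXind N).comp (fun _ => truncWeight (β * √N) (level 1 N))
        fun _ => measurable_truncWeight _ _)
      (fun σ => (measurable_truncWeight _ _).comp_aemeasurable (hX N σ).aemeasurable)
      (fun _ _ => truncWeight_nonneg _ _ _) (fun _ _ => truncWeight_le_one _ _ _)
      (fun σ => ((hX N σ).integral_comp
        (measurable_truncWeight _ _).aestronglyMeasurable).le) (4 * C * √N)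
    refine h.trans (Real.exp_le_exp.mpr ?_)
    rw [card_config, Nat.cast_pow, Nat.cast_ofNat, ← Real.sqrt_eq_rpow]
    linarith
  set p := 1 / 2 + γ with hp
  -- The expected number of exceedances is at least of order `N^γ`, so none occurs with probability
  -- at most `exp(-c N^γ)`.
  have hmax : ∀ᵐ ω ∂P, ∀ᶠ N : ℕ in atTop, ω ∉ {ω | ∀ σ, X N σ ω ≤ level p N} := by
    refine ae_eventually_notMem_of_exp_bound (γ := γ)
      (c := (√(2 * Real.pi))⁻¹ * Real.exp (-(betaC + 1))) (by positivity) hγ ?_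
    filter_upwards [le_two_pow_mul_gaussianReal_level p] with N hN
    refine (measureReal_forall_le_le (hX N) (hXind N) _).trans (Real.exp_le_exp.mpr ?_)
    rw [card_config, Nat.cast_pow, Nat.cast_ofNat]
    rw [hp, add_sub_cancel_left] at hN
    linarith
  have hlim1 : Tendsto (fun N : ℕ => 4 * C * (N : ℝ) ^ (1 / 2 - a * (1 / 2 - γ))) atTop (𝓝 0) := by
    have h := ((tendsto_rpow_neg_atTop (neg_pos.mpr hexp)).comp
      (tendsto_natCast_atTop_atTop (R := ℝ))).const_mul (4 * C)
    simpa [Function.comp_def] using h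
  have hlim2 : Tendsto (fun N : ℕ => 4 * C / √(N : ℝ)) atTop (𝓝 0) :=
    tendsto_const_nhds.div_atTop tendsto_sqrt_natCast
  filter_upwards [hS, hmax] with ω h1 h2
  filter_upwards [h1, h2, hlim1.eventually_le_const (show (0 : ℝ) < 1 / 4 by norm_num),
    hlim2.eventually_le_const (show (0 : ℝ) < 1 / 4 by norm_num), hk.eventually_ge_atTop 1,
    eventually_gt_atTop 0] with N hS hmax h3 h4 hkN hN
  have hN' : (0 : ℝ) < N := Nat.cast_pos.mpr hN
  have hs : 0 < √(N : ℝ) := Real.sqrt_pos.mpr hN'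
  have hNk : N ≤ k N := by
    rw [le_div_iff₀ hN', one_mul] at hkN
    exact_mod_cast hkN
  have hk0 : 0 < k N := hN.trans_le hNk
  refine ⟨hk0, ?_⟩
  simp only [not_forall, not_le] at hS hmax
  obtain ⟨σ₀, hσ₀⟩ := hmax
  have hβ0 : 0 < β := hc.trans hβ
  -- Both error terms are shown to be at most `1/4`, whence the bound `2(1 - 1/4 - 1/4) = 1`.
  have key := dTV_gibbs_uniformLowest_ge (H := hamiltonian fun α => J N α ω) (β := β)
    (s := β * √N) (x := level 1 N) (X := fun σ => X N σ ω) (k := k N)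
    (fun σ => by rw [hamiltonian_eq]; ring) (by positivity) hσ₀ hk0
  have e1 : Real.exp (-(β * √N * (level p N - level 1 N))) = (N : ℝ) ^ (-(a * (1 / 2 - γ))) := by
    rw [Real.rpow_def_of_pos hN', level, level, hp, ha]
    congr 1
    field_simp
    ring
  have b1 : S N ω * Real.exp (-(β * √N * (level p N - level 1 N))) ≤ 1 / 4 := by
    refine le_trans ?_ h3
    rw [e1, sub_eq_add_neg (1 / 2) (a * _), Real.rpow_add hN', ← Real.sqrt_eq_rpow, ← mul_assoc]
    gcongr
  have b2 : S N ω / ((min (k N) (2 ^ N) : ℕ) : ℝ) ≤ 1 / 4 := by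
    refine le_trans ?_ h4
    have hmin : (N : ℝ) ≤ ((min (k N) (2 ^ N) : ℕ) : ℝ) :=
      Nat.cast_le.mpr (le_min hNk Nat.lt_two_pow_self.le)
    calc _ ≤ 4 * C * √N / (√N * √N) := by
          rw [Real.mul_self_sqrt hN'.le]
          gcongr
      _ = _ := by field_simp
  linarith

end REM

theorem mainTheorem10 {Ω : Type*} [MeasurableSpace Ω] (P : Measure Ω) [IsProbabilityMeasure P]
    (J : (N : ℕ) → Finset (Fin N) → Ω → ℝ)
    (hJ_law : ∀ N α, HasLaw (J N α) (gaussianReal 0 1) P)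
    (hJ_indep : ∀ N, iIndepFun (J N) P)
    (W : ℕ → Ω → ℝ)
    (hW_law : ∀ i, HasLaw (W i) (expMeasure 1) P)
    (hW_indep : iIndepFun W P)
    (β : ℝ) (hβ : REM.betaC < β)
    (k : ℕ → ℕ)
    (hk : Tendsto k atTop atTop)
    (hk_lower : Tendsto (fun N : ℕ => (k N : ℝ) / N) atTop atTop)
    (hk_upper : Tendsto (fun N : ℕ => Real.log (k N) * Real.log N / N) atTop (𝓝 0)) :
    ∀ᵐ ω ∂P,
      (∀ᶠ N : ℕ in atTop,
        REM.gibbs (REM.hamiltonian fun α => J N α ω) β ≠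
          REM.uniformLowest (REM.hamiltonian fun α => J N α ω) (k N)) ∧
      Tendsto (REM.zetaPartial β fun i => W i ω) atTop (𝓝 (REM.zeta β fun i => W i ω)) ∧
      0 < 1 / (1 + REM.zeta β fun i => W i ω) ∧
      1 / (1 + REM.zeta β fun i => W i ω) ≤
        liminf (fun N : ℕ =>
          REM.dTV (REM.gibbs (REM.hamiltonian fun α => J N α ω) β)
            (REM.uniformLowest (REM.hamiltonian fun α => J N α ω) (k N))) atTop := by
  have hc := REM.betaC_pos
  filter_upwards [REM.ae_tendsto_zetaPartial hW_law hW_indep ((one_lt_div hc).mpr hβ),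
    REM.ae_eventually_one_le_dTV hJ_law hJ_indep hβ hk_lower] with ω ⟨hζ, hζ0⟩ hd
  refine ⟨hd.mono fun N hN heq => ?_, hζ, by positivity, ?_⟩
  · have h := hN.2
    rw [← heq] at h
    linarith [REM.dTV_self (REM.gibbs (REM.hamiltonian fun α => J N α ω) β)]
  · refine le_liminf_of_le ?_ (hd.mono fun N hN => ?_)
    -- A real `liminf` is meaningful only with an upper bound, here the trivial bound 2.
    · refine IsCoboundedUnder.of_frequently_le (a := 2) (hd.mono fun N hN => ?_).frequently
      have := REM.isProbabilityMeasure_uniformLowest (REM.hamiltonian fun α => J N α ω) hN.1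
      exact REM.dTV_le_two _ _
    -- Since `ζ ≥ 0`, the claimed bound is at most 1.
    · exact ((div_le_one (by linarith)).mpr (by linarith)).trans hN.2
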